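/- Let $(A,E)$ be a finite undirected graph, where self-edges and multiple edges are allowed, and let $E_0\subseteq E$ be the set of edges that are not self-edges. Let $A=\{x_1,\dots,x_n\}$ be any ordering of the vertices and put $A_j=A\setminus\{x_1,\dots,x_{j-1}\}$. A loop in $A_j$ rooted at $x_j$ is a sequence of vertices $\omega^j_0,\omega^j_1,\dots,\omega^j_m\in A_j$ ($m\ge 0$) with $\omega^j_0=\omega^j_m=x_j$, together with a sequence of undirected edges $e_1,\dots,e_m\in E$ such that the endpoints of $e_i$ are $\omega^j_{i-1}$ and $\omega^j_i$. Write $N_j=N_j(\omega^j)=\#\{i\ge 1:\omega^j_i=x_j\}$. For an $n$-tuple $\bar\omega=(\omega^1,\dots,\omega^n)$, where $\omega^j$ is a loop in $A_j$ rooted at $x_j$, let $\pi(\bar\omega)\in\mathbb N^E$ be the function that gives the total number of traversals of each edge by $\omega^1,\dots,\omega^n$. For $e\in E$ and $x\in A$ let $n_e(x)=2$ if $e$ is a self-edge at $x$, $n_e(x)=1$ if $e\in E_0$ and $x$ is an endpoint of $e$, and $n_e(x)=0$ otherwise. For $\bar k=(k_e)_{e\in E}\in\mathbb N^E$ (where $0\in\mathbb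 N$) put $$n_x=\frac12\sum_{e\in E}k_e\,n_e(x),\qquad S(\bar k)=\sum_{e\in E_0}k_e ,$$ and call $\bar k$ a current if $n_x$ is an integer for each $x\in A$. Then for every current $\bar k$ there are only finitely many tuples $\bar\omega$ with $\pi(\bar\omega)=\bar k$, and $$2^{-S(\bar k)}\sum_{\bar\omega:\ \pi(\bar\omega)=\bar k}\ \prod_{j=1}^n\frac{\Gamma(N_j+\frac12)}{N_j!}=\Bigl[\prod_{x\in A}\Gamma\bigl(n_x+\tfrac12\bigr)\Bigr]\Bigl[\prod_{e\in E}\frac1{k_e!}\Bigr].$$ -/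

import Mathlib

open scoped Graph

namespace Multigraph

variable {α β : Type*}

/-- A walk from `u` to `w` in the vertex set `B` of the multigraph `G`: a finite sequence of
vertices of `B` together with a sequence of undirected edges of `G` such that the endpoints of
each edge are the two consecutive vertices. `nil` is the trivial walk (of length zero), and `cons`
prepends one traversal of an edge. A self-edge can be traversed in only one way. -/
inductive Walk (G : Graph α β) (B : Set α) : α → α → Type _
  | nil (u : α) (hu : u ∈ B) : Walk G B u u
  | cons {u v w : α} (e : β) (hu : u ∈ B) (h : G.IsLink e u v) (p : Walk G B v w) : Walk G B u w

/-- The sequence of edges `e₁, …, eₘ` traversed by a walk. -/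
def Walk.edges {G : Graph α β} {B : Set α} : {u w : α} → Walk G B u w → List β
  | _, _, .nil _ _ => []
  | _, _, .cons e _ _ p => e :: p.edges

/-- The sequence `ω₀, ω₁, …, ωₘ` of vertices of a walk. -/
def Walk.support {G : Graph α β} {B : Set α} : {u w : α} → Walk G B u w → List α
  | _, _, .nil u _ => [u]
  | u, _, .cons _ _ _ p => u :: p.support

/-- A loop in `B` rooted at `r`. -/
abbrev Loop (G : Graph α β) (B : Set α) (r : α) := Walk G B r r

open Classical in
/-- The number `#{i ≥ 1 : ωᵢ = r}` of elementary loops in a loop rooted at `r`. -/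
noncomputable def Loop.numElementary {G : Graph α β} {B : Set α} {r : α} (l : Loop G B r) : ℕ :=
  l.support.tail.count r

/-- The set `A_j`, that is `A` without the vertices that precede `x_j` in the ordering `x`. -/
def remaining {G : Graph α β} {n : ℕ} (x : Fin n ≃ V(G)) (j : Fin n) : Set α :=
  V(G) \ {v | ∃ i < j, (x i : α) = v}

/-- Ordered tuples `(ω¹, …, ωⁿ)`, where `ωʲ` is a loop in `A_j` rooted at `x_j`. -/
abbrev LoopTuple (G : Graph α β) {n : ℕ} (x : Fin n ≃ V(G)) :=
  ∀ j : Fin n, Loop G (remaining x j) (x j : α)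

open Classical in
/-- The map `π`: the total number of traversals of each edge by a tuple of loops. -/
noncomputable def LoopTuple.traversals {G : Graph α β} {n : ℕ} {x : Fin n ≃ V(G)}
    (ω : LoopTuple G x) : E(G) → ℕ :=
  fun e => ∑ j, (ω j).edges.count (e : β)

open Classical in
/-- `n_e(v)`: it is `2` if `e` is a self-edge at `v`, `1` if `e` joins `v` to another vertex, and
`0` if `e` does not touch `v`. -/
noncomputable def touch (G : Graph α β) (e : β) (v : α) : ℕ :=
  if G.IsLoopAt e v then 2 else if G.IsNonloopAt e v then 1 else 0

/-- The vertex local time `n_v = ½ ∑ₑ kₑ nₑ(v)`. -/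
noncomputable def localTime (G : Graph α β) [Fintype E(G)] (k : E(G) → ℕ) (v : α) : ℝ :=
  1 / 2 * ∑ e : E(G), (k e : ℝ) * (touch G (e : β) v : ℝ)

/-- `k` is a current if the local time of every vertex is an integer. -/
def IsCurrent (G : Graph α β) [Fintype E(G)] (k : E(G) → ℕ) : Prop :=
  ∀ v ∈ V(G), ∃ m : ℤ, localTime G k v = m

open Classical in
/-- `S(k)`, the sum of `kₑ` over the edges that are not self-edges. -/
noncomputable def nonSelfTotal (G : Graph α β) [Fintype E(G)] (k : E(G) → ℕ) : ℕ :=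
  ∑ e : E(G), if ∃ v, G.IsLoopAt (e : β) v then 0 else k e

end Multigraph

/-! Peel off the loop rooted at the first vertex. The later loops avoid that vertex, so the first
loop must use up all edges there; its `N` is then forced to be half the degree, its factor is
constant, and induction on `n` evaluates the remaining loops. What is left is to sum the closed form
for the remaining current over all such first loops. This sum is found for walks from any `u` to the
root `r`. The closed form `pathWeight` has `Γ(d/2 + 1)` at the current position and `Γ(d/2 + 1/2)`
elsewhere, `d` being the degree in the current. Traversing `e` takes the share `kₑ nₑ(u) / d(u)` of
it (`pathWeight_step`). The shares add up to one, so first-step decomposition and induction on the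
total current give `pathSum_eq`; `tsum_loopTuple` then carries out the peeling. -/

namespace Multigraph

/-! ### Walks, edge counts and degrees -/

section

open Classical

variable {α β : Type*} {G : Graph α β} {B : Set α} {u v w r : α}

/-- The number of traversals of each edge by a walk. -/
noncomputable def Walk.traversals (p : Walk G B u w) : E(G) → ℕ :=
  fun e => p.edges.count (e : β)

@[simp]
lemma Walk.traversals_nil (hu : u ∈ B) : (Walk.nil u hu : Walk G B u u).traversals = 0 := by
  ext e
  simp [Walk.traversals, Walk.edges]

lemma Walk.traversals_cons {e : β} (hu : u ∈ B) (h : G.IsLink e u v) (p : Walk G B v w) :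
    (Walk.cons e hu h p).traversals = p.traversals + Pi.single ⟨e, h.edge_mem⟩ 1 := by
  ext f
  simp only [Walk.traversals, Walk.edges, List.count_cons, Pi.add_apply, Pi.single_apply,
    Subtype.ext_iff, beq_iff_eq]
  congr 1
  exact if_congr eq_comm rfl rfl

lemma Walk.start_mem (p : Walk G B u w) : u ∈ B := by
  cases p <;> assumption

lemma Walk.mem_of_isLink_of_traversals_ne_zero (p : Walk G B u w) {e : E(G)}
    (he : p.traversals e ≠ 0) {a b : α} (hab : G.IsLink (e : β) a b) : a ∈ B := by
  induction p with
  | nil u hu => simp at he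
  | @cons u v w f hu h p ih =>
    by_cases hp : p.traversals e = 0
    · rw [Walk.traversals_cons, Pi.add_apply, hp, zero_add, Pi.single_apply] at he
      have hef : e = ⟨f, h.edge_mem⟩ := by
        by_contra hne
        simp [hne] at he
      subst hef
      rcases hab.left_eq_or_eq h with rfl | rfl
      · exact hu
      · exact p.start_mem
    · exact ih hp

/-- From a known starting vertex, each edge determines the next vertex. -/
lemma Walk.edges_injective : ∀ {u : α}, Function.Injective
    (Walk.edges : Walk G B u w → List β) := by
  intro u p
  induction p with
  | nil u hu =>
    intro q hq
    cases q with
    | nil => rfl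
    | cons => simp [Walk.edges] at hq
  | @cons u v w e hu h p ih =>
    intro q hq
    cases q with
    | nil => simp [Walk.edges] at hq
    | @cons _ v' _ e' hu' h' q =>
      simp only [Walk.edges, List.cons.injEq] at hq
      obtain ⟨rfl, hq⟩ := hq
      obtain rfl := h.right_unique h'
      rw [ih hq]

lemma Walk.length_edges [Fintype E(G)] (p : Walk G B u w) :
    p.edges.length = ∑ e, p.traversals e := by
  induction p with
  | nil u hu => simp [Walk.edges]
  | cons e hu h p ih =>
    simp [Walk.edges, Walk.traversals_cons, Finset.sum_add_distrib, ih]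

lemma Walk.edges_mem (p : Walk G B u w) : ∀ e ∈ p.edges, e ∈ E(G) := by
  induction p with
  | nil u hu => simp [Walk.edges]
  | cons e hu h p ih =>
    intro f hf
    rcases List.mem_cons.1 hf with rfl | hf
    · exact h.edge_mem
    · exact ih f hf

lemma Walk.finite_traversals_le [Fintype E(G)] (k : E(G) → ℕ) :
    {p : Walk G B u w | p.traversals ≤ k}.Finite := by
  have hfin : (List.map (Subtype.val : E(G) → β) ''
      {l : List E(G) | l.length ≤ ∑ e, k e}).Finite :=
    (List.finite_length_le E(G) (∑ e, k e)).image _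
  refine (hfin.preimage (f := Walk.edges) Walk.edges_injective.injOn).subset ?_
  intro p hp
  refine ⟨p.edges.attachWith _ p.edges_mem, ?_, ?_⟩
  · simpa [Walk.length_edges] using Finset.sum_le_sum fun e _ => hp e
  · simp

lemma touch_eq_of_isLink {e : β} (h : G.IsLink e u v) (a : α) :
    touch G e a = (if u = a then 1 else 0) + (if v = a then 1 else 0) := by
  unfold touch
  by_cases huv : u = v
  · subst huv
    by_cases hua : u = a
    · subst hua
      simp [show G.IsLoopAt e u from h]
    · have h1 : ¬ G.IsLoopAt e a := fun hl => hua (by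
        rcases h.left_eq_or_eq hl with h | h <;> exact h)
      have h2 : ¬ G.IsNonloopAt e a := Graph.IsLoopAt.not_isNonloopAt (x := u) h a
      simp [h1, h2, hua]
  · have h1 : ∀ a, ¬ G.IsLoopAt e a := by
      intro a hl
      rcases h.eq_and_eq_or_eq_and_eq hl with ⟨h1, h2⟩ | ⟨h1, h2⟩ <;> exact huv (h1.trans h2.symm)
    rw [if_neg (h1 a)]
    by_cases hua : u = a
    · subst hua
      have : G.IsNonloopAt e u := ⟨v, Ne.symm huv, h⟩
      simp [this, Ne.symm huv]
    · by_cases hva : v = a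
      · subst hva
        have : G.IsNonloopAt e v := ⟨u, huv, h.symm⟩
        simp [this, huv]
      · have : ¬ G.IsNonloopAt e a := by
          intro hn
          rcases hn.inc.eq_or_eq_of_isLink h with h | h
          · exact hua h.symm
          · exact hva h.symm
        simp [this, hua, hva]

lemma exists_isLoopAt_iff {e : β} (h : G.IsLink e u v) : (∃ a, G.IsLoopAt e a) ↔ u = v := by
  constructor
  · rintro ⟨a, ha⟩
    rcases h.eq_and_eq_or_eq_and_eq ha with ⟨h1, h2⟩ | ⟨h1, h2⟩ <;> exact h1.trans h2.symm
  · rintro rfl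
    exact ⟨u, h⟩

/-- The walks which start at `u`, sorted by their first step. -/
def Walk.ofFirstStep (hu : u ∈ B) :
    PLift (u = r) ⊕ (Σ e : E(G), Σ v : {v // G.IsLink (e : β) u v}, Walk G B v r) → Walk G B u r
  | .inl h => h.down ▸ .nil u hu
  | .inr ⟨e, v, p⟩ => .cons (e : β) hu v.2 p

lemma Walk.ofFirstStep_bijective (hu : u ∈ B) :
    Function.Bijective (Walk.ofFirstStep (G := G) (r := r) hu) := by
  constructor
  · rintro (⟨⟨rfl⟩⟩ | ⟨⟨e, he⟩, ⟨v, hv⟩, p⟩) (⟨⟨h⟩⟩ | ⟨⟨e', he'⟩, ⟨v', hv'⟩, p'⟩) hpq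
    · rfl
    · simp [ofFirstStep] at hpq
    · subst h
      simp [ofFirstStep] at hpq
    · simp only [ofFirstStep, Walk.cons.injEq] at hpq
      obtain ⟨rfl, rfl, hpq⟩ := hpq
      rw [eq_of_heq hpq]
  · intro p
    cases p with
    | nil => exact ⟨.inl ⟨rfl⟩, rfl⟩
    | cons e _ h p => exact ⟨.inr ⟨⟨e, h.edge_mem⟩, ⟨_, h⟩, p⟩, rfl⟩

variable [Fintype E(G)]

/-- The degree of a vertex with the edges counted with multiplicity, twice the local time. -/
noncomputable def degree (k : E(G) → ℕ) (v : α) : ℕ :=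
  ∑ e, k e * touch G (e : β) v

lemma localTime_eq (k : E(G) → ℕ) (v : α) : localTime G k v = (degree k v : ℝ) / 2 := by
  simp [localTime, degree]
  ring

lemma degree_add (k l : E(G) → ℕ) (v : α) : degree (k + l) v = degree k v + degree l v := by
  simp [degree, add_mul, Finset.sum_add_distrib]

@[simp]
lemma degree_zero (v : α) : degree (0 : E(G) → ℕ) v = 0 := by
  simp [degree]

lemma degree_single (e : E(G)) (v : α) : degree (Pi.single e 1) v = touch G (e : β) v := by
  simp [degree, Pi.single_apply]

/-- Handshake count: each step contributes one to the degree where it leaves and one where it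
arrives. The two indicators correct for the end points, and cancel for a loop. -/
lemma Walk.degree_traversals (p : Walk G B u w) (a : α) :
    2 * p.support.tail.count a + (if u = a then 1 else 0) =
      degree p.traversals a + (if w = a then 1 else 0) := by
  have hs : ∀ {u w : α} (p : Walk G B u w), p.support = u :: p.support.tail := by
    intro u w p
    cases p <;> rfl
  induction p with
  | nil u hu => simp [Walk.support]
  | @cons u v w e hu h p ih =>
    rw [Walk.traversals_cons, degree_add, degree_single, touch_eq_of_isLink h a]
    simp only [Walk.support, List.tail_cons]
    rw [hs p, List.count_cons]
    simp only [beq_iff_eq]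
    omega

lemma Loop.degree_traversals (l : Loop G B r) (a : α) :
    degree (Walk.traversals l) a = 2 * l.support.tail.count a := by
  have := Walk.degree_traversals l a
  omega

end

/-! ### The closed form and its one-step recursion -/

section

open Classical

variable {α β : Type*} {G : Graph α β} {B : Set α} {u v w r : α}
variable [Fintype E(G)]

/-- The edge factor `2 ^ S(k) / ∏ kₑ!`. -/
noncomputable def edgeWeight (k : E(G) → ℕ) : ℝ :=
  2 ^ nonSelfTotal G k / ∏ e, ((k e).factorial : ℝ)

lemma edgeWeight_pos (k : E(G) → ℕ) : 0 < edgeWeight k := by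
  unfold edgeWeight
  positivity

lemma prod_factorial_add_single (k : E(G) → ℕ) (e : E(G)) :
    ∏ f, (((k + Pi.single e 1 : E(G) → ℕ) f).factorial : ℝ) = (∏ f, ((k f).factorial : ℝ)) * (k e + 1) := by
  rw [← Finset.mul_prod_erase _ _ (Finset.mem_univ e),
    ← Finset.mul_prod_erase Finset.univ (fun f => ((k f).factorial : ℝ)) (Finset.mem_univ e)]
  have : ∏ f ∈ Finset.univ.erase e, (((k + Pi.single e 1 : E(G) → ℕ) f).factorial : ℝ) =
      ∏ f ∈ Finset.univ.erase e, ((k f).factorial : ℝ) := by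
    refine Finset.prod_congr rfl fun f hf => ?_
    simp [Finset.ne_of_mem_erase hf]
  rw [this]
  simp [Nat.factorial_succ]
  ring

lemma nonSelfTotal_add_single (k : E(G) → ℕ) (e : E(G)) :
    nonSelfTotal G (k + Pi.single e 1) =
      nonSelfTotal G k + if ∃ v, G.IsLoopAt (e : β) v then 0 else 1 := by
  have : ∀ f : E(G), (if ∃ v, G.IsLoopAt (f : β) v then 0 else (k + Pi.single e 1 : E(G) → ℕ) f) =
      (if ∃ v, G.IsLoopAt (f : β) v then 0 else k f) +
        if f = e then (if ∃ v, G.IsLoopAt (e : β) v then 0 else 1) else 0 := by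
    intro f
    by_cases hf : f = e
    · subst hf
      simp only [if_true, Pi.add_apply, Pi.single_eq_same]
      split_ifs <;> rfl
    · simp [hf]
  simp only [nonSelfTotal, this, Finset.sum_add_distrib, Finset.sum_ite_eq', Finset.mem_univ,
    if_true]

lemma edgeWeight_add_single (k : E(G) → ℕ) (e : E(G)) :
    edgeWeight (k + Pi.single e 1) * (k e + 1) =
      edgeWeight k * if ∃ v, G.IsLoopAt (e : β) v then 1 else 2 := by
  unfold edgeWeight
  rw [prod_factorial_add_single, nonSelfTotal_add_single]
  have : (∏ f, ((k f).factorial : ℝ)) ≠ 0 := by positivity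
  have : (k e + 1 : ℝ) ≠ 0 := by positivity
  split_ifs <;> field_simp <;> ring

/-- The closed form of the sum over the walks which start at `u`. -/
noncomputable def pathWeight (B : Finset α) (u : α) (k : E(G) → ℕ) : ℝ :=
  edgeWeight k * (Real.Gamma ((degree k u : ℝ) / 2 + 1) *
    ∏ v ∈ B.erase u, Real.Gamma ((degree k v : ℝ) / 2 + 1 / 2))

lemma pathWeight_nonneg (B : Finset α) (u : α) (k : E(G) → ℕ) : 0 ≤ pathWeight B u k := by
  have h1 : 0 < Real.Gamma ((degree k u : ℝ) / 2 + 1) := Real.Gamma_pos_of_pos (by positivity)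
  have h2 : 0 < ∏ v ∈ B.erase u, Real.Gamma ((degree k v : ℝ) / 2 + 1 / 2) :=
    Finset.prod_pos fun v _ => Real.Gamma_pos_of_pos (by positivity)
  have h3 := edgeWeight_pos k
  unfold pathWeight
  positivity

/-- Removing one copy of `e` and moving from `u` to `v` moves the extra `1/2` in the Gamma argument
from `u` to `v`, so only the functional equation at `u` is needed. -/
lemma pathWeight_step {B : Finset α} (hu : u ∈ B) (hv : v ∈ B) (k : E(G) → ℕ) (e : E(G))
    (h : G.IsLink (e : β) u v) :
    pathWeight B u (k + Pi.single e 1) * ((k e + 1) * touch G (e : β) u) =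
      pathWeight B v k * degree (k + Pi.single e 1) u := by
  have hdeg : ∀ a, degree (k + Pi.single e 1) a =
      degree k a + ((if u = a then 1 else 0) + (if v = a then 1 else 0)) := by
    intro a
    rw [degree_add, degree_single, touch_eq_of_isLink h]
  have hE := edgeWeight_add_single k e
  rw [if_congr (exists_isLoopAt_iff h) rfl rfl] at hE
  rw [touch_eq_of_isLink h]
  unfold pathWeight
  by_cases huv : u = v
  · subst huv
    have hP : ∏ a ∈ B.erase u, Real.Gamma ((degree (k + Pi.single e 1) a : ℝ) / 2 + 1 / 2) =
        ∏ a ∈ B.erase u, Real.Gamma ((degree k a : ℝ) / 2 + 1 / 2) := by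
      refine Finset.prod_congr rfl fun a ha => ?_
      simp [hdeg, (Finset.ne_of_mem_erase ha).symm]
    rw [hP, hdeg u]
    simp only [if_true, mul_one] at hE ⊢
    -- A self-edge raises the degree by two; its touch number 2 replaces the missing power of two in
    -- the edge factor.
    have hG : Real.Gamma (((degree k u + (1 + 1) : ℕ) : ℝ) / 2 + 1) =
        ((degree k u : ℝ) / 2 + 1) * Real.Gamma ((degree k u : ℝ) / 2 + 1) := by
      rw [← Real.Gamma_add_one (by positivity)]
      congr 1
      push_cast
      ring
    rw [hG, ← hE]
    push_cast
    ring
  · have hu' : u ∈ B.erase v := Finset.mem_erase.2 ⟨huv, hu⟩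
    have hv' : v ∈ B.erase u := Finset.mem_erase.2 ⟨Ne.symm huv, hv⟩
    rw [← Finset.mul_prod_erase _ _ hu', ← Finset.mul_prod_erase _ _ hv',
      Finset.erase_right_comm (a := v)]
    have hP : ∏ a ∈ (B.erase u).erase v,
          Real.Gamma ((degree (k + Pi.single e 1) a : ℝ) / 2 + 1 / 2) =
        ∏ a ∈ (B.erase u).erase v, Real.Gamma ((degree k a : ℝ) / 2 + 1 / 2) := by
      refine Finset.prod_congr rfl fun a ha => ?_
      have h1 := (Finset.ne_of_mem_erase ha).symm
      have h2 := (Finset.ne_of_mem_erase (Finset.mem_of_mem_erase ha)).symm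
      simp [hdeg, h1, h2]
    rw [hP, hdeg u, hdeg v]
    simp only [huv, Ne.symm huv, if_false, if_true, add_zero, zero_add] at hE ⊢
    have hG : Real.Gamma (((degree k u + 1 : ℕ) : ℝ) / 2 + 1) =
        (((degree k u : ℝ) + 1) / 2) * Real.Gamma ((degree k u : ℝ) / 2 + 1 / 2) := by
      rw [show (degree k u : ℝ) / 2 + 1 / 2 = ((degree k u : ℝ) + 1) / 2 by ring,
        ← Real.Gamma_add_one (by positivity)]
      push_cast
      rfl
    have hG' : Real.Gamma (((degree k v + 1 : ℕ) : ℝ) / 2 + 1 / 2) =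
        Real.Gamma ((degree k v : ℝ) / 2 + 1) := by
      congr 1
      push_cast
      ring
    -- This `1/2` matches the one that the functional equation produces in `hG`.
    have hE' : edgeWeight k = edgeWeight (k + Pi.single e 1) * (k e + 1) / 2 := by
      rw [hE]
      ring
    rw [hG, hG', hE']
    push_cast
    ring

/-- Values in `ENNReal` let sums over infinitely many walks be rearranged without summability
conditions. -/
lemma Walk.tsum_eq (hu : u ∈ B) (f : Walk G B u r → ENNReal) :
    ∑' p, f p = (∑' h : PLift (u = r), f (h.down ▸ .nil u hu)) +
      ∑ e : E(G), ∑' v : {v // G.IsLink (e : β) u v}, ∑' p : Walk G B v r,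
        f (.cons (e : β) hu v.2 p) := by
  rw [← (Equiv.ofBijective _ (Walk.ofFirstStep_bijective hu)).tsum_eq,
    Summable.tsum_sum (M := ENNReal) ENNReal.summable ENNReal.summable]
  congr 1
  rw [ENNReal.tsum_sigma', tsum_fintype]
  refine Finset.sum_congr rfl fun e _ => ?_
  rw [ENNReal.tsum_sigma']
  rfl

end

/-! ### Summation over walks by first-step decomposition -/

section

open Classical

variable {α β : Type*} {G : Graph α β} {u v w r : α}

lemma touch_eq_zero {e : β} (he : e ∈ E(G)) (h : ∀ v, ¬ G.IsLink e u v) : touch G e u = 0 := by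
  obtain ⟨a, b, hab⟩ := Graph.exists_isLink_of_mem_edgeSet he
  rw [touch_eq_of_isLink hab]
  have ha : a ≠ u := by
    rintro rfl
    exact h _ hab
  have hb : b ≠ u := by
    rintro rfl
    exact h _ hab.symm
  simp [ha, hb]

lemma touch_pos {e : β} (h : G.IsLink e u v) : 0 < touch G e u := by
  rw [touch_eq_of_isLink h]
  simp

variable [Fintype E(G)]

lemma single_le_degree (k : E(G) → ℕ) (e : E(G)) (v : α) :
    k e * touch G (e : β) v ≤ degree k v :=
  Finset.single_le_sum (f := fun e : E(G) => k e * touch G (e : β) v) (fun _ _ => Nat.zero_le _)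
    (Finset.mem_univ e)

/-- The sum over all walks from `u` to `r` that use up the edges at `r`, each weighted by the
closed form for the remaining current. -/
noncomputable def pathSum (B : Finset α) (r u : α) (k : E(G) → ℕ) : ENNReal :=
  ∑' p : Walk G (B : Set α) u r, if p.traversals ≤ k ∧ degree (k - p.traversals) r = 0 then
    ENNReal.ofReal (pathWeight B r (k - p.traversals)) else 0

/-- The parity hypothesis is the one satisfied by `k` when a walk from `u` to `r` can be removed to
leave even degrees. -/
theorem pathSum_eq {B : Finset α} (hu : u ∈ B) (k : E(G) → ℕ)
    (hsupp : ∀ e, k e ≠ 0 → ∀ a b, G.IsLink (e : β) a b → a ∈ B)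
    (hpar : ∀ a ∈ B, Even (degree k a + (if u = a then 1 else 0) + (if r = a then 1 else 0))) :
    pathSum B r u k = ENNReal.ofReal (pathWeight B u k) := by
  induction hn : ∑ e, k e using Nat.strong_induction_on generalizing k u with
  | _ n ih =>
  have hstep : ∀ e : E(G), (∑' v : {v // G.IsLink (e : β) u v}, ∑' p : Walk G (B : Set α) v r,
      if (Walk.cons (e : β) hu v.2 p).traversals ≤ k ∧
          degree (k - (Walk.cons (e : β) hu v.2 p).traversals) r = 0 then
        ENNReal.ofReal (pathWeight B r (k - (Walk.cons (e : β) hu v.2 p).traversals)) else 0) =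
      ENNReal.ofReal (pathWeight B u k * ((k e * touch G (e : β) u) / degree k u)) := by
    intro e
    by_cases hke : k e = 0
    · rw [hke]
      simp only [Nat.cast_zero, zero_mul, zero_div, mul_zero, ENNReal.ofReal_zero,
        ENNReal.tsum_eq_zero]
      intro v p
      rw [if_neg]
      rintro ⟨hle, -⟩
      have := hle e
      rw [Walk.traversals_cons] at this
      simp [hke] at this
    obtain ⟨k', rfl⟩ : ∃ k', k = k' + Pi.single e 1 := by
      refine ⟨k - Pi.single e 1, (tsub_add_cancel_of_le ?_).symm⟩
      intro f
      by_cases hf : f = e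
      · subst hf
        simp
        omega
      · simp [hf]
    by_cases hl : ∃ v, G.IsLink (e : β) u v
    · obtain ⟨v, hv⟩ := hl
      have hvB : v ∈ B := hsupp e hke v u hv.symm
      rw [tsum_eq_single (⟨v, hv⟩ : {v // G.IsLink (e : β) u v})
        (fun b hb => absurd (Subtype.ext (b.2.right_unique hv)) hb)]
      have hsum : ∑ e, k' e < n := by
        rw [← hn]
        simp [Finset.sum_add_distrib]
      -- The traversal changes the degree parities exactly as moving the start from `u` to `v` does.
      have hrec := ih _ hsum hvB k' (fun f hf => hsupp f (by simp [hf])) (by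
        intro a ha
        have := hpar a ha
        rw [degree_add, degree_single, touch_eq_of_isLink hv] at this
        rw [Nat.even_iff] at this ⊢
        omega) rfl
      have hdeg : (degree (k' + Pi.single e 1) u : ℝ) ≠ 0 := by
        rw [degree_add, degree_single]
        have := touch_pos hv
        positivity
      have hw := pathWeight_step hu hvB k' e hv
      have hw' : pathWeight B u (k' + Pi.single e 1) *
          ((((k' + Pi.single e 1 : E(G) → ℕ) e : ℕ) : ℝ) * touch G (e : β) u /
            degree (k' + Pi.single e 1) u) = pathWeight B v k' := by
        rw [← mul_div_assoc, div_eq_iff hdeg, ← hw]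
        simp
      rw [hw', ← hrec, pathSum]
      refine tsum_congr fun p => ?_
      rw [Walk.traversals_cons, Subtype.coe_eta]
      simp only [add_le_add_iff_right, add_tsub_add_eq_tsub_right]
    · have : IsEmpty {v // G.IsLink (e : β) u v} := ⟨fun v => hl ⟨v.1, v.2⟩⟩
      rw [touch_eq_zero e.2 fun v hv => hl ⟨v, hv⟩]
      simp
  rw [pathSum, Walk.tsum_eq hu, Finset.sum_congr rfl fun e _ => hstep e,
    ← ENNReal.ofReal_sum_of_nonneg fun e _ =>
      mul_nonneg (pathWeight_nonneg B u k) (by positivity), ← Finset.mul_sum, ← Finset.sum_div]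
  have hsum : ∑ e : E(G), (k e : ℝ) * (touch G (e : β) u : ℝ) = degree k u := by
    simp [degree]
  rw [hsum]
  -- In degree zero, parity forces `u = r`: the trivial walk gives everything, and the shares vanish
  -- because division by zero is zero. Otherwise the trivial walk contributes nothing and the shares
  -- add up to one.
  by_cases hdeg : degree k u = 0
  · have hur : u = r := by
      by_contra hne
      have := hpar u hu
      simp [hdeg, Ne.symm hne] at this
    subst hur
    rw [tsum_eq_single ⟨rfl⟩ (fun b hb => absurd (Subsingleton.elim _ _) hb)]
    simp [hdeg]
  · have hz : ∀ h : PLift (u = r), (if (h.down ▸ Walk.nil u hu : Walk G (B : Set α) u r).traversals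
        ≤ k ∧ degree (k - (h.down ▸ Walk.nil u hu : Walk G (B : Set α) u r).traversals) r = 0 then
        ENNReal.ofReal (pathWeight B r
          (k - (h.down ▸ Walk.nil u hu : Walk G (B : Set α) u r).traversals)) else 0) = 0 := by
      rintro ⟨rfl⟩
      simp [hdeg]
    rw [ENNReal.tsum_eq_zero.2 hz, div_self (by exact_mod_cast hdeg)]
    simp

end

/-! ### Peeling off the loops one root at a time -/

section

open Classical

variable {α β : Type*} {G : Graph α β} [Fintype E(G)]

lemma Walk.degree_traversals_eq_zero {B : Set α} {u w a : α} (p : Walk G B u w) (ha : a ∉ B) :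
    degree p.traversals a = 0 := by
  refine Finset.sum_eq_zero fun e _ => ?_
  by_contra hne
  obtain ⟨h1, h2⟩ := mul_ne_zero_iff.1 hne
  have : ∃ v, G.IsLink (e : β) a v := by
    by_contra hl
    exact h2 (touch_eq_zero e.2 fun v hv => hl ⟨v, hv⟩)
  obtain ⟨v, hv⟩ := this
  exact ha (p.mem_of_isLink_of_traversals_ne_zero h1 hv)

lemma degree_sum {ι : Type*} (s : Finset ι) (f : ι → E(G) → ℕ) (a : α) :
    degree (∑ i ∈ s, f i) a = ∑ i ∈ s, degree (f i) a := by
  simp only [degree, Finset.sum_apply, Finset.sum_mul]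
  exact Finset.sum_comm

lemma loop_tsum_eq {S : Set α} {B : Finset α} (hS : S = B) {r : α} (hr : r ∈ B) (k : E(G) → ℕ)
    (hsupp : ∀ e, k e ≠ 0 → ∀ a b, G.IsLink (e : β) a b → a ∈ B)
    (hpar : ∀ a ∈ B, Even (degree k a)) :
    (∑' p : Loop G S r, if Walk.traversals p ≤ k ∧ degree (k - Walk.traversals p) r = 0 then
      ENNReal.ofReal (pathWeight B r (k - Walk.traversals p)) else 0) =
      ENNReal.ofReal (pathWeight B r k) := by
  subst hS
  refine pathSum_eq hr k hsupp fun a ha => ?_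
  have := hpar a ha
  rw [Nat.even_iff] at this ⊢
  omega

/-- The factor `Γ(N + 1/2) / N!` of a loop. -/
noncomputable def Loop.weight {S : Set α} {r : α} (l : Loop G S r) : ℝ :=
  Real.Gamma ((l.numElementary : ℝ) + 1 / 2) / (l.numElementary.factorial : ℝ)

omit [Fintype E(G)] in
lemma Loop.weight_pos {S : Set α} {r : α} (l : Loop G S r) : 0 < l.weight := by
  have : 0 < Real.Gamma ((l.numElementary : ℝ) + 1 / 2) := Real.Gamma_pos_of_pos (by positivity)
  unfold Loop.weight
  positivity

/-- The vertices need not exhaust `G`, only carry `k`; this lets the induction drop `x 0` while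
keeping the graph. -/
theorem tsum_loopTuple {n : ℕ} (x : Fin n → α) (hx : Function.Injective x) (S : Fin n → Set α)
    (hS : ∀ j, S j = x '' Set.Ici j) (k : E(G) → ℕ)
    (hsupp : ∀ e, k e ≠ 0 → ∀ a b, G.IsLink (e : β) a b → a ∈ Set.range x)
    (hpar : ∀ j, Even (degree k (x j))) :
    (∑' ω : ∀ j, Loop G (S j) (x j), if ∑ j, Walk.traversals (ω j) = k then
      ∏ j, ENNReal.ofReal (ω j).weight else 0) =
      ENNReal.ofReal (edgeWeight k * ∏ j, Real.Gamma ((degree k (x j) : ℝ) / 2 + 1 / 2)) := by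
  induction n generalizing k with
  | zero =>
    have hk : k = 0 := by
      ext e
      by_contra hne
      obtain ⟨a, b, hab⟩ := Graph.exists_isLink_of_mem_edgeSet e.2
      obtain ⟨j, -⟩ := hsupp e hne a b hab
      exact j.elim0
    subst hk
    rw [tsum_eq_single (fun j => j.elim0) (fun b hb => absurd (Subsingleton.elim _ _) hb)]
    simp [edgeWeight, nonSelfTotal]
  | succ n ih =>
    set F : Finset α := Finset.univ.image x with hF
    have hSF : S 0 = (F : Set α) := by
      rw [hS 0, hF]
      ext a
      simp
    have hFe : F.erase (x 0) = Finset.univ.image fun j : Fin n => x j.succ := by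
      ext a
      simp only [hF, Finset.mem_erase, Finset.mem_image, Finset.mem_univ, true_and]
      constructor
      · rintro ⟨hne, j, rfl⟩
        obtain ⟨i, rfl⟩ := Fin.exists_succ_eq.2 (fun h : j = 0 => hne (by rw [h]))
        exact ⟨i, rfl⟩
      · rintro ⟨i, rfl⟩
        exact ⟨fun h => Fin.succ_ne_zero i (hx h), i.succ, rfl⟩
    have hprod : ∀ l : E(G) → ℕ,
        ∏ v ∈ F.erase (x 0), Real.Gamma ((degree l v : ℝ) / 2 + 1 / 2) =
        ∏ j : Fin n, Real.Gamma ((degree l (x j.succ) : ℝ) / 2 + 1 / 2) := by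
      intro l
      rw [hFe, Finset.prod_image]
      intro i _ j _ hij
      exact Fin.succ_injective _ (hx hij)
    have hS' : ∀ j : Fin n, S j.succ = (fun j : Fin n => x j.succ) '' Set.Ici j := by
      intro j
      rw [hS]
      ext a
      constructor
      · rintro ⟨i, hi, rfl⟩
        obtain ⟨i, rfl⟩ := Fin.exists_succ_eq.2
          (fun h : i = 0 => absurd (h ▸ hi : j.succ ≤ 0) (not_le.2 (Fin.succ_pos j)))
        exact ⟨i, Fin.succ_le_succ_iff.1 hi, rfl⟩
      · rintro ⟨i, hi, rfl⟩
        exact ⟨i.succ, Fin.succ_le_succ_iff.2 hi, rfl⟩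
    have hx0 : ∀ j : Fin n, x 0 ∉ S j.succ := by
      intro j h
      rw [hS' j] at h
      obtain ⟨i, -, hi⟩ := h
      exact Fin.succ_ne_zero i (hx hi)
    -- The factor of any first loop that uses up the edges at `x 0`; it turns the `Γ(d/2 + 1)` of
    -- `pathWeight` into `Γ(d/2 + 1/2)`.
    set C : ℝ := Real.Gamma ((degree k (x 0) : ℝ) / 2 + 1 / 2) /
      Real.Gamma ((degree k (x 0) : ℝ) / 2 + 1) with hC
    have hC0 : 0 ≤ C := div_nonneg (Real.Gamma_pos_of_pos (by positivity)).le
      (Real.Gamma_pos_of_pos (by positivity)).le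
    have hinner : ∀ l : Loop G (S 0) (x 0),
        (∑' ω : ∀ j : Fin n, Loop G (S j.succ) (x j.succ),
          if Walk.traversals l + ∑ j, Walk.traversals (ω j) = k then
            ENNReal.ofReal l.weight * ∏ j, ENNReal.ofReal (ω j).weight else 0) =
        ENNReal.ofReal C *
          if Walk.traversals l ≤ k ∧ degree (k - Walk.traversals l) (x 0) = 0 then
            ENNReal.ofReal (pathWeight F (x 0) (k - Walk.traversals l)) else 0 := by
      intro l
      by_cases hl : Walk.traversals l ≤ k ∧ degree (k - Walk.traversals l) (x 0) = 0
      · rw [if_pos hl]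
        obtain ⟨hle, hdeg⟩ := hl
        obtain ⟨k', rfl⟩ := exists_add_of_le hle
        rw [add_tsub_cancel_left] at hdeg ⊢
        have hw : l.weight = C := by
          have hN : degree (Walk.traversals l + k') (x 0) = 2 * l.numElementary := by
            rw [degree_add, hdeg, Loop.degree_traversals]
            rfl
          rw [hC, hN, Loop.weight]
          push_cast
          rw [mul_div_cancel_left₀ _ (two_ne_zero), Real.Gamma_nat_eq_factorial]
        have hpath : pathWeight F (x 0) k' = edgeWeight k' *
            ∏ j : Fin n, Real.Gamma ((degree k' (x j.succ) : ℝ) / 2 + 1 / 2) := by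
          rw [pathWeight, hdeg, hprod]
          simp
        rw [hpath, ← ih (fun j => x j.succ) (fun i j hij => Fin.succ_injective _ (hx hij))
          (fun j => S j.succ) hS' k', hw, ← ENNReal.tsum_mul_left]
        · refine tsum_congr fun ω => ?_
          rw [mul_ite, mul_zero]
          exact if_congr (add_right_inj _) rfl rfl
        · intro e he a b hab
          obtain ⟨j, rfl⟩ := hsupp e (by simp [he]) a b hab
          -- An edge still in `k'` cannot touch `x 0`, whose remaining degree is zero.
          obtain ⟨i, rfl⟩ := Fin.exists_succ_eq.2 (fun h : j = 0 => by
            subst h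
            have h1 := single_le_degree k' e (x 0)
            have h2 := Nat.mul_pos (Nat.pos_of_ne_zero he) (touch_pos hab)
            omega)
          exact ⟨i, rfl⟩
        · intro j
          have := hpar j.succ
          rw [degree_add, Loop.degree_traversals] at this
          rw [Nat.even_iff] at this ⊢
          omega
      · rw [if_neg hl, mul_zero, ENNReal.tsum_eq_zero]
        intro ω
        refine if_neg ?_
        rintro rfl
        refine hl ⟨le_self_add, ?_⟩
        rw [add_tsub_cancel_left, degree_sum]
        exact Finset.sum_eq_zero fun j _ => Walk.degree_traversals_eq_zero _ (hx0 j)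
    rw [← (Fin.consEquiv fun j => Loop G (S j) (x j)).tsum_eq, ENNReal.tsum_prod']
    simp only [Fin.consEquiv, Equiv.coe_fn_mk, Fin.sum_univ_succ, Fin.prod_univ_succ, Fin.cons_zero,
      Fin.cons_succ]
    rw [tsum_congr hinner, ENNReal.tsum_mul_left, loop_tsum_eq hSF (by simp [hF]) k,
      ← ENNReal.ofReal_mul hC0, pathWeight, hprod]
    · congr 1
      have : Real.Gamma ((degree k (x 0) : ℝ) / 2 + 1) ≠ 0 :=
        (Real.Gamma_pos_of_pos (by positivity)).ne'
      rw [hC]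
      field_simp
    · intro e he a b hab
      obtain ⟨j, rfl⟩ := hsupp e he a b hab
      simp [hF]
    · intro a ha
      obtain ⟨j, -, rfl⟩ := Finset.mem_image.1 ha
      exact hpar j

end

end Multigraph

/-! ### The theorem: finiteness and the return to real sums -/

open Multigraph in
theorem mainTheorem2 {α β : Type*} (G : Graph α β) [Fintype V(G)] [Fintype E(G)]
    {n : ℕ} (x : Fin n ≃ V(G)) (k : E(G) → ℕ) (hk : Multigraph.IsCurrent G k) :
    {ω : Multigraph.LoopTuple G x | ω.traversals = k}.Finite ∧
    ((2 : ℝ) ^ Multigraph.nonSelfTotal G k)⁻¹ *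
        ∑ᶠ ω ∈ {ω : Multigraph.LoopTuple G x | ω.traversals = k},
          ∏ j : Fin n, Real.Gamma (((ω j).numElementary : ℝ) + 1 / 2) /
            ((ω j).numElementary.factorial : ℝ) =
      (∏ v : V(G), Real.Gamma (Multigraph.localTime G k (v : α) + 1 / 2)) *
        ∏ e : E(G), 1 / ((k e).factorial : ℝ) := by
  classical
  have htrav : ∀ ω : LoopTuple G x, ω.traversals = ∑ j, Walk.traversals (ω j) := by
    intro ω
    ext e
    simp [LoopTuple.traversals, Walk.traversals]
  have hfin : {ω : LoopTuple G x | ω.traversals = k}.Finite := by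
    -- Each loop separately traverses at most `k`, which bounds its length.
    refine (Set.Finite.pi' fun j : Fin n => Walk.finite_traversals_le (G := G)
      (B := remaining x j) (u := (x j : α)) (w := (x j : α)) k).subset ?_
    intro ω hω j
    have hω' : ∑ j, Walk.traversals (ω j) = k := (htrav ω).symm.trans hω
    rw [Set.mem_ofPred_eq, ← hω']
    exact Finset.single_le_sum (f := fun j => Walk.traversals (ω j)) (fun _ _ => zero_le)
      (Finset.mem_univ j)
  refine ⟨hfin, ?_⟩
  have hpar : ∀ v ∈ V(G), Even (degree k v) := by
    intro v hv
    obtain ⟨m, hm⟩ := hk v hv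
    rw [localTime_eq, div_eq_iff two_ne_zero] at hm
    have : (degree k v : ℤ) = m * 2 := by exact_mod_cast hm
    rw [Nat.even_iff]
    omega
  have hrem : ∀ j, remaining x j = (fun i => (x i : α)) '' Set.Ici j := by
    intro j
    ext a
    simp only [remaining, Set.mem_sdiff, Set.mem_ofPred_eq, Set.mem_image, Set.mem_Ici]
    constructor
    · rintro ⟨ha, hna⟩
      obtain ⟨i, hi⟩ := x.surjective ⟨a, ha⟩
      have hia : (x i : α) = a := congrArg Subtype.val hi
      exact ⟨i, not_lt.1 fun hij => hna ⟨i, hij, hia⟩, hia⟩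
    · rintro ⟨i, hi, rfl⟩
      refine ⟨(x i).2, ?_⟩
      rintro ⟨i', hi', h⟩
      rw [x.injective (Subtype.ext h)] at hi'
      exact absurd hi (not_le.2 hi')
  have hmain := tsum_loopTuple (fun j => (x j : α)) (Subtype.val_injective.comp x.injective)
    (remaining x) hrem k (fun e _ a b hab => by
      obtain ⟨i, hi⟩ := x.surjective ⟨a, hab.left_mem⟩
      exact ⟨i, congrArg Subtype.val hi⟩) (fun j => hpar _ (x j).2)
  rw [tsum_eq_sum (s := hfin.toFinset) (by
      intro ω hω
      refine if_neg fun h => hω ?_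
      exact hfin.mem_toFinset.2 ((htrav ω).trans h)),
    Finset.sum_congr rfl (g := fun ω : LoopTuple G x => ENNReal.ofReal (∏ j, (ω j).weight)) (by
      intro ω hω
      rw [if_pos ((htrav ω).symm.trans (hfin.mem_toFinset.1 hω)),
        ENNReal.ofReal_prod_of_nonneg fun j _ => (Loop.weight_pos _).le]),
    ← ENNReal.ofReal_sum_of_nonneg fun ω _ => Finset.prod_nonneg fun j _ => (Loop.weight_pos _).le,
    ENNReal.ofReal_eq_ofReal_iff
      (Finset.sum_nonneg fun ω _ => Finset.prod_nonneg fun j _ => (Loop.weight_pos _).le)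
      (mul_nonneg (edgeWeight_pos k).le
        (Finset.prod_nonneg fun j _ => (Real.Gamma_pos_of_pos (by positivity)).le))] at hmain
  rw [finsum_mem_eq_finite_toFinset_sum _ hfin]
  change _ * ∑ ω ∈ hfin.toFinset, ∏ j, (ω j).weight = _
  rw [hmain, ← Equiv.prod_comp x]
  simp only [localTime_eq, edgeWeight, Finset.prod_div_distrib, Finset.prod_const_one]
  field_simp
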